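/- All Banach spaces are complex. For Banach spaces $V,W$ let $\mathcal F(V,W)$ be the space of continuous finite-rank operators $V\to W$ with the operator norm, let $\mathcal F(V)=\mathcal F(V,V)$, and let $\mathcal A(V)$ be the algebra of approximable operators, i.e. the operator-norm closure of $\mathcal F(V)$ in $\mathcal B(V)$. A Banach algebra $\mathcal A$ is $K$-amenable if it has an approximate diagonal of bound $K$: a net $(d_\alpha)$ in the completed projective tensor product $\mathcal A\widehat\otimes\mathcal A$ with $\|d_\alpha\|_\wedge\le K$ for all $\alpha$ such that $\pi(d_\alpha)a\to a$ and $a\,d_\alpha-d_\alpha\,a\to 0$ for every $a\in\mathcal A$, where $\pi(a\otimes b)=ab$, $a\,(b\otimes c)=ab\otimes c$ and $(b\otimes c)\,a=b\otimes ca$. For an infinite-dimensional Banach space $Z$ and $T\in\mathcal F(V,W)$ put \[\gamma_Z(T)=\inf\{\|R\|\,\|S\| : RS=T,\ S\in\mathcal F(V,Z),\ R\in\mathcal F(Z,W)\}.\] An infinite-dimensional Banach space $Z$ has the factorization-norm property if $\gamma_Z$ is a norm on $\mathcal F(V,W)$ for every pair of Banach spaces $(V,W)$. A bilinear map $\varphi:E\times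 F\to G$ between normed spaces is $M$-open if for every $z\in G$ there are $x\in E$, $y\in F$ with $\varphi(x,y)=z$ and $\|x\|\,\|y\|\le M\|z\|$. Theorem. Let $X$ be an infinite-dimensional Banach space such that $\mathcal A(X)$ is $K$-amenable, let $P$ be a bounded projection on $X$, and set $Y=\mathrm{rg}\,P$ and $Z=\mathrm{rg}\,(I-P)$. Suppose that both $Y$ and $Z$ have the factorization-norm property. Then there are constants $\kappa\ge 0$ and $M$ with \[\kappa\le 4K^2\,\|P\|\,\|I-P\|\,\max\{\|P\|^4,\|I-P\|^4\},\qquad M\le\kappa^2K^2\,\|P\|\,\|I-P\|,\] such that at least one of the composition maps \[\varphi_Y:\mathcal F(Z,Y)\times\mathcal F(Y,Z)\to\mathcal F(Y),\qquad \varphi_Z:\mathcal F(Y,Z)\times\mathcal F(Z,Y)\to\mathcal F(Z),\qquad (R,S)\mapsto RS,\] is $M$-open. -/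

import Mathlib

open Filter Topology
open scoped TensorProduct

universe u

noncomputable section

/-! ### Finite-rank and approximable operators -/

section FiniteRank

variable (X Y : Type*) [NormedAddCommGroup X] [NormedSpace ℂ X]
  [NormedAddCommGroup Y] [NormedSpace ℂ Y]

/-- The space `F(X, Y)` of continuous finite-rank operators, with the operator norm. -/
def finiteRank : Submodule ℂ (X →L[ℂ] Y) where
  carrier := {T | FiniteDimensional ℂ (LinearMap.range T.toLinearMap)}
  zero_mem' := by
    change FiniteDimensional ℂ (LinearMap.range (0 : X →ₗ[ℂ] Y))
    rw [LinearMap.range_zero]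
    infer_instance
  add_mem' := by
    intro S T hS hT
    change FiniteDimensional ℂ _ at hS hT
    change FiniteDimensional ℂ _
    refine Submodule.finiteDimensional_of_le (S₂ :=
      LinearMap.range S.toLinearMap ⊔ LinearMap.range T.toLinearMap) ?_
    rintro _ ⟨x, rfl⟩
    exact Submodule.add_mem_sup ⟨x, rfl⟩ ⟨x, rfl⟩
  smul_mem' := by
    intro c T hT
    change FiniteDimensional ℂ _ at hT
    change FiniteDimensional ℂ _
    refine Submodule.finiteDimensional_of_le (S₂ := LinearMap.range T.toLinearMap) ?_
    rintro _ ⟨x, rfl⟩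
    exact ⟨c • x, by simp⟩

variable {X Y}

theorem mem_finiteRank {T : X →L[ℂ] Y} :
    T ∈ finiteRank X Y ↔ FiniteDimensional ℂ (LinearMap.range T.toLinearMap) := Iff.rfl

theorem comp_mem_finiteRank {W : Type*} [NormedAddCommGroup W] [NormedSpace ℂ W]
    {R : X →L[ℂ] Y} (hR : R ∈ finiteRank X Y) (S : W →L[ℂ] X) :
    R ∘L S ∈ finiteRank W Y := by
  rw [mem_finiteRank] at hR ⊢
  refine Submodule.finiteDimensional_of_le (S₂ := LinearMap.range R.toLinearMap) ?_
  rintro _ ⟨x, rfl⟩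
  exact ⟨S x, rfl⟩

/-- The product map `F(Z, Y) × F(W, Z) → F(W, Y)`, `(R, S) ↦ R S`, as a bilinear map. -/
def finiteRankComp (W Z Y : Type*) [NormedAddCommGroup W] [NormedSpace ℂ W]
    [NormedAddCommGroup Z] [NormedSpace ℂ Z] [NormedAddCommGroup Y] [NormedSpace ℂ Y] :
    finiteRank Z Y →ₗ[ℂ] finiteRank W Z →ₗ[ℂ] finiteRank W Y :=
  LinearMap.mk₂ ℂ (fun R S => ⟨R.1 ∘L S.1, comp_mem_finiteRank R.2 S.1⟩)
    (fun _ _ _ => by ext; simp) (fun _ _ _ => by ext; simp)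
    (fun _ _ _ => by ext; simp) (fun _ _ _ => by ext; simp)

@[simp]
theorem finiteRankComp_coe (W Z Y : Type*) [NormedAddCommGroup W] [NormedSpace ℂ W]
    [NormedAddCommGroup Z] [NormedSpace ℂ Z] [NormedAddCommGroup Y] [NormedSpace ℂ Y]
    (R : finiteRank Z Y) (S : finiteRank W Z) :
    (finiteRankComp W Z Y R S : W →L[ℂ] Y) = (R : Z →L[ℂ] Y) ∘L (S : W →L[ℂ] Z) := rfl

variable (X)

/-- `F(X)` as a (non-unital) subalgebra of `B(X)`. -/
def finiteRankAlgebra : NonUnitalSubalgebra ℂ (X →L[ℂ] X) where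
  __ := finiteRank X X
  mul_mem' := fun {_ b} ha _ => comp_mem_finiteRank ha b

/-- The algebra `A(X)` of approximable operators: the operator norm closure of `F(X)` in `B(X)`. -/
def approximableAlgebra : NonUnitalSubalgebra ℂ (X →L[ℂ] X) :=
  (finiteRankAlgebra X).topologicalClosure

instance : NormedSpace ℂ (approximableAlgebra X) where
  norm_smul_le c T := norm_smul_le c (T : X →L[ℂ] X)

instance [CompleteSpace X] : CompleteSpace (approximableAlgebra X) :=
  (NonUnitalSubalgebra.isClosed_topologicalClosure (finiteRankAlgebra X)).completeSpace_coe

end FiniteRank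

/-! ### The projective tensor square of a Banach algebra and `K`-amenability -/

section Amenable

variable (A : Type u) [NonUnitalNormedRing A] [NormedSpace ℂ A] [IsScalarTower ℂ A A]
  [SMulCommClass ℂ A A]

/-- The completed projective tensor product of `A` with itself: the completion of the algebraic
tensor product for the projective norm (Mathlib's norm on `PiTensorProduct`). -/
abbrev ProjTensorSq : Type u := UniformSpace.Completion (⨂[ℂ] _ : Fin 2, A)

/-- The product `(a, b) ↦ a b` as a continuous multilinear map of two variables. -/
def mulMultilinear : ContinuousMultilinearMap ℂ (fun _ : Fin 2 => A) A :=
  MultilinearMap.mkContinuous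
    { toFun := fun m => m 0 * m 1
      map_update_add' := by
        intro _ m i x y
        fin_cases i <;> simp [Function.update, add_mul, mul_add]
      map_update_smul' := by
        intro _ m i c x
        fin_cases i <;> simp [Function.update, smul_mul_assoc, mul_smul_comm] }
    1 (fun m => by simpa using norm_mul_le (m 0) (m 1))

/-- The continuous linear map `π` on the completed projective tensor square with
`π (a ⊗ b) = a b`. -/
def projMul [CompleteSpace A] : ProjTensorSq A →L[ℂ] A :=
  (PiTensorProduct.liftIsometry ℂ (fun _ : Fin 2 => A) A (mulMultilinear A)).extend
    (UniformSpace.Completion.toComplL (𝕜 := ℂ))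

variable {A}

/-- The continuous linear map on the completed projective tensor square with
`b ⊗ c ↦ f b ⊗ g c`. -/
def projMap (f g : A →L[ℂ] A) : ProjTensorSq A →L[ℂ] ProjTensorSq A :=
  ((UniformSpace.Completion.toComplL (𝕜 := ℂ)) ∘L
    PiTensorProduct.mapL (E := fun _ : Fin 2 => A) (E' := fun _ : Fin 2 => A) ![f, g]).extend
      (UniformSpace.Completion.toComplL (𝕜 := ℂ))

/-- The left module action `a · (b ⊗ c) = a b ⊗ c`. -/
def projLeft (a : A) : ProjTensorSq A →L[ℂ] ProjTensorSq A :=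
  projMap (ContinuousLinearMap.mul ℂ A a) (ContinuousLinearMap.id ℂ A)

/-- The right module action `(b ⊗ c) · a = b ⊗ c a`. -/
def projRight (a : A) : ProjTensorSq A →L[ℂ] ProjTensorSq A :=
  projMap (ContinuousLinearMap.id ℂ A) ((ContinuousLinearMap.mul ℂ A).flip a)

theorem projMul_coe [CompleteSpace A] (t : ⨂[ℂ] _ : Fin 2, A) :
    projMul A (t : ProjTensorSq A) =
      PiTensorProduct.liftIsometry ℂ (fun _ : Fin 2 => A) A (mulMultilinear A) t :=
  ContinuousLinearMap.extend_eq _ UniformSpace.Completion.denseRange_coe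
    (UniformSpace.Completion.isUniformInducing_coe _) t

theorem projMul_tprod [CompleteSpace A] (m : Fin 2 → A) :
    projMul A ((PiTensorProduct.tprod ℂ m : ⨂[ℂ] _ : Fin 2, A) : ProjTensorSq A) = m 0 * m 1 := by
  rw [projMul_coe]
  simp [mulMultilinear]

theorem projMap_coe (f g : A →L[ℂ] A) (t : ⨂[ℂ] _ : Fin 2, A) :
    projMap f g (t : ProjTensorSq A) =
      ((PiTensorProduct.mapL (E := fun _ : Fin 2 => A) (E' := fun _ : Fin 2 => A) ![f, g] t :
        ⨂[ℂ] _ : Fin 2, A) : ProjTensorSq A) :=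
  ContinuousLinearMap.extend_eq _ UniformSpace.Completion.denseRange_coe
    (UniformSpace.Completion.isUniformInducing_coe _) t

theorem projMap_tprod (f g : A →L[ℂ] A) (m : Fin 2 → A) :
    projMap f g ((PiTensorProduct.tprod ℂ m : ⨂[ℂ] _ : Fin 2, A) : ProjTensorSq A) =
      ((PiTensorProduct.tprod ℂ ![f (m 0), g (m 1)] : ⨂[ℂ] _ : Fin 2, A) : ProjTensorSq A) := by
  rw [projMap_coe]
  congr 1
  simp only [PiTensorProduct.mapL_apply, PiTensorProduct.map_tprod]
  congr 1
  ext i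
  fin_cases i <;> rfl

variable (A)

/-- `A` is `K`-amenable: there is an approximate diagonal of bound `K`, i.e. a net `(d i)` in the
completed projective tensor square of `A` with `‖d i‖ ≤ K`, `π (d i) a → a` and
`a · d i - d i · a → 0` for every `a` in `A`. -/
def IsKAmenable [CompleteSpace A] (K : ℝ) : Prop :=
  ∃ (ι : Type u) (_ : Preorder ι) (_ : IsDirectedOrder ι) (_ : Nonempty ι)
    (d : ι → ProjTensorSq A),
    (∀ i, ‖d i‖ ≤ K) ∧
    (∀ a : A, Tendsto (fun i => projMul A (d i) * a) atTop (𝓝 a)) ∧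
    (∀ a : A, Tendsto (fun i => projLeft a (d i) - projRight a (d i)) atTop (𝓝 0))

end Amenable

/-! ### The factorization-norm property and open bilinear maps -/

/-- `N` is a norm on the complex vector space `V`. -/
structure IsNormOn {V : Type*} [AddCommGroup V] [Module ℂ V] (N : V → ℝ) : Prop where
  nonneg : ∀ v, 0 ≤ N v
  eq_zero_iff : ∀ v, N v = 0 ↔ v = 0
  smul : ∀ (c : ℂ) v, N (c • v) = ‖c‖ * N v
  add_le : ∀ v w, N (v + w) ≤ N v + N w

/-- `γ_Z(T)`: the infimum of `‖R‖ ‖S‖` over the factorizations `T = R S` with `S ∈ F(X, Z)` and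
`R ∈ F(Z, Y)`. (When `Z` is infinite dimensional such factorizations exist for every `T` in
`F(X, Y)`.) -/
def gammaNorm (Z : Type*) [NormedAddCommGroup Z] [NormedSpace ℂ Z]
    {X Y : Type*} [NormedAddCommGroup X] [NormedSpace ℂ X]
    [NormedAddCommGroup Y] [NormedSpace ℂ Y] (T : finiteRank X Y) : ℝ :=
  sInf {r : ℝ | ∃ (R : finiteRank Z Y) (S : finiteRank X Z),
    finiteRankComp X Z Y R S = T ∧ r = ‖R‖ * ‖S‖}

/-- An infinite-dimensional space `Z` has the factorization-norm property if `γ_Z` is a norm on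
`F(X, Y)` for every pair of Banach spaces `(X, Y)`. -/
structure HasFactorizationNormProperty (Z : Type u) [NormedAddCommGroup Z] [NormedSpace ℂ Z] :
    Prop where
  infinite_dimensional : ¬ FiniteDimensional ℂ Z
  isNormOn : ∀ (X Y : Type u) [NormedAddCommGroup X] [NormedSpace ℂ X] [CompleteSpace X]
    [NormedAddCommGroup Y] [NormedSpace ℂ Y] [CompleteSpace Y],
    IsNormOn (fun T : finiteRank X Y => gammaNorm Z T)

/-- A bilinear map `φ : E × F → G` is `M`-open if every `z` in `G` is of the form `φ(x, y)` with
`‖x‖ ‖y‖ ≤ M ‖z‖`. -/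
def IsMOpen {E F G : Type*} [NormedAddCommGroup E] [NormedSpace ℂ E]
    [NormedAddCommGroup F] [NormedSpace ℂ F] [NormedAddCommGroup G] [NormedSpace ℂ G]
    (φ : E →ₗ[ℂ] F →ₗ[ℂ] G) (M : ℝ) : Prop :=
  ∀ z : G, ∃ (x : E) (y : F), φ x y = z ∧ ‖x‖ * ‖y‖ ≤ M * ‖z‖

/-- The range of a bounded operator, as a subspace. -/
abbrev rg {X : Type*} [NormedAddCommGroup X] [NormedSpace ℂ X] (P : X →L[ℂ] X) :
    Submodule ℂ X := LinearMap.range P.toLinearMap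

end

/-!
Let `u i` be the image of an approximate diagonal `d i` of `A(X)` under `a ⊗ b ↦ a P b`. These
operators are bounded and commute asymptotically with rank-one operators, which forces
`φ ∘ u i → μ φ` in norm for every functional `φ`, along an ultrafilter. With `Q = 1 - P` in place of
`P` the limit is some `ν φ`, and `μ + ν = 1` because `π (d i)` is a left approximate identity; so
one of `μ`, `ν`, say `μ`, has modulus at least `1 / 2`.

For `T` in `F(rg Q)` every `T Q (a P b)`, restricted to `rg Q`, factors through `Y = rg P`. Since
`γ_Y` satisfies the triangle inequality, a sum of such terms is controlled by the sum of the factor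
norms, whence `γ_Y(T Q (u i)) ≤ K ‖P‖ ‖Q‖ ‖T‖`. On operators of the form `T S` with `T` of finite
rank, `γ_Y` is controlled by finitely many functionals `φ ∘ S`, so the convergence `φ ∘ u i → μ φ`
suffices to pass to the limit: `|μ| γ_Y(T) ≤ K ‖P‖ ‖Q‖ ‖T‖`.
-/

noncomputable section

section ProjTensorSq

variable {A : Type u} [NonUnitalNormedRing A] [NormedSpace ℂ A]

/-- The elementary tensor `m 0 ⊗ m 1` in the completed projective tensor square of `A`. -/
abbrev ProjTensorSq.tprod (m : Fin 2 → A) : ProjTensorSq A :=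
  ((PiTensorProduct.tprod ℂ m : ⨂[ℂ] _ : Fin 2, A) : ProjTensorSq A)

theorem ProjTensorSq.seminorm_le {N : Seminorm ℂ (ProjTensorSq A)} (hN : Continuous N) {C : ℝ}
    (hC : 0 ≤ C) (h : ∀ m, N (tprod m) ≤ C * (‖m 0‖ * ‖m 1‖)) (d : ProjTensorSq A) :
    N d ≤ C * ‖d‖ := by
  induction d using UniformSpace.Completion.induction_on with
  | hp => exact isClosed_le hN (continuous_const.mul continuous_norm)
  | ih t =>
    rw [UniformSpace.Completion.norm_coe, PiTensorProduct.norm_def, Real.mul_iInf_of_nonneg hC]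
    refine le_ciInf fun ⟨p, hp⟩ => ?_
    dsimp only [PiTensorProduct.projectiveSeminormAux]
    rw [← (PiTensorProduct.mem_lifts_iff t p).1 hp]
    induction p.toList with
    | nil => simp [UniformSpace.Completion.coe_zero]
    | cons q l ih =>
      have hq : N (↑(q.1 • PiTensorProduct.tprod ℂ q.2)) ≤
          C * (‖q.1‖ * ∏ k, ‖q.2 k‖) := by
        rw [UniformSpace.Completion.coe_smul, map_smul_eq_mul, Fin.prod_univ_two, mul_left_comm]
        exact mul_le_mul_of_nonneg_left (h q.2) (norm_nonneg _)
      simp only [List.map_cons, List.sum_cons, UniformSpace.Completion.coe_add, mul_add]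
      exact (map_add_le_add N _ _).trans (add_le_add hq ih)

theorem ProjTensorSq.clm_ext {G : Type*} [NormedAddCommGroup G] [NormedSpace ℂ G]
    {f g : ProjTensorSq A →L[ℂ] G} (h : ∀ m, f (tprod m) = g (tprod m)) : f = g := by
  ext d
  have hN : Continuous ((normSeminorm ℂ G).comp (f - g : ProjTensorSq A →L[ℂ] G).toLinearMap) :=
    (f - g).continuous.norm
  have hle := seminorm_le hN le_rfl (fun m => by simp [h]) d
  rw [zero_mul] at hle
  exact sub_eq_zero.1 (norm_le_zero_iff.1 hle)

end ProjTensorSq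

section TwistedMul

variable {A : Type u} [NonUnitalNormedRing A] [NormedSpace ℂ A] [IsScalarTower ℂ A A]
  [SMulCommClass ℂ A A] [CompleteSpace A]

/-- The continuous linear map `a ⊗ b ↦ f a * b`. For `f` the right multiplication by `B`
it inserts `B` between the two factors of a tensor. -/
def twistedMul (f : A →L[ℂ] A) : ProjTensorSq A →L[ℂ] A :=
  projMul A ∘L projMap f (.id ℂ A)

theorem twistedMul_tprod (f : A →L[ℂ] A) (m : Fin 2 → A) :
    twistedMul f (ProjTensorSq.tprod m) = f (m 0) * m 1 := by
  simp [twistedMul, projMap_tprod, projMul_tprod]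

theorem twistedMul_projLeft {f : A →L[ℂ] A} (hf : ∀ a b, f (a * b) = a * f b) (a : A)
    (d : ProjTensorSq A) : twistedMul f (projLeft a d) = a * twistedMul f d := by
  have : twistedMul f ∘L projLeft a = ContinuousLinearMap.mul ℂ A a ∘L twistedMul f :=
    ProjTensorSq.clm_ext fun m => by
      simp [projLeft, projMap_tprod, twistedMul_tprod, hf, mul_assoc]
  exact DFunLike.congr_fun this d

theorem twistedMul_projRight (f : A →L[ℂ] A) (a : A) (d : ProjTensorSq A) :
    twistedMul f (projRight a d) = twistedMul f d * a := by
  have : twistedMul f ∘L projRight a =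
      (ContinuousLinearMap.mul ℂ A).flip a ∘L twistedMul f :=
    ProjTensorSq.clm_ext fun m => by
      simp [projRight, projMap_tprod, twistedMul_tprod, mul_assoc]
  exact DFunLike.congr_fun this d

theorem tendsto_commutator_twistedMul {ι : Type*} {l : Filter ι} {d : ι → ProjTensorSq A} {a : A}
    (hd : Tendsto (fun i => projLeft a (d i) - projRight a (d i)) l (𝓝 0))
    {f : A →L[ℂ] A} (hf : ∀ a b, f (a * b) = a * f b) :
    Tendsto (fun i => a * twistedMul f (d i) - twistedMul f (d i) * a) l (𝓝 0) := by
  simpa only [Function.comp_def, map_sub, map_zero, twistedMul_projLeft hf, twistedMul_projRight]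
    using ((twistedMul f).continuous.tendsto 0).comp hd

theorem norm_projMul_le (d : ProjTensorSq A) : ‖projMul A d‖ ≤ ‖d‖ := by
  have hN : Continuous ((normSeminorm ℂ A).comp (projMul A).toLinearMap) :=
    (projMul A).continuous.norm
  rw [← one_mul ‖d‖]
  refine ProjTensorSq.seminorm_le hN zero_le_one (fun m => ?_) d
  calc ‖projMul A (ProjTensorSq.tprod m)‖ = ‖m 0 * m 1‖ := by rw [projMul_tprod]
    _ ≤ 1 * (‖m 0‖ * ‖m 1‖) := by simpa only [one_mul] using norm_mul_le _ _

theorem IsKAmenable.one_le [Nontrivial A] {K : ℝ} (hK : IsKAmenable A K) : 1 ≤ K := by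
  obtain ⟨ι, _, _, _, d, hd, happrox, -⟩ := hK
  obtain ⟨a, ha⟩ := exists_ne (0 : A)
  have hle : ‖a‖ ≤ K * ‖a‖ := le_of_tendsto' (happrox a).norm fun i =>
    (norm_mul_le _ _).trans <|
      mul_le_mul_of_nonneg_right ((norm_projMul_le _).trans (hd i)) (norm_nonneg a)
  exact (le_mul_iff_one_le_left (norm_pos_iff.2 ha)).1 hle

end TwistedMul

section FiniteRank

variable {X Y Z : Type*} [NormedAddCommGroup X] [NormedSpace ℂ X]
  [NormedAddCommGroup Y] [NormedSpace ℂ Y] [NormedAddCommGroup Z] [NormedSpace ℂ Z]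

theorem comp_mem_finiteRank_right (R : Y →L[ℂ] Z) {S : X →L[ℂ] Y} (hS : S ∈ finiteRank X Y) :
    R ∘L S ∈ finiteRank X Z := by
  rw [mem_finiteRank] at hS ⊢
  rw [ContinuousLinearMap.toLinearMap_comp, LinearMap.range_comp]
  infer_instance

theorem smulRight_mem_finiteRank (φ : X →L[ℂ] ℂ) (y : Y) : φ.smulRight y ∈ finiteRank X Y := by
  rw [mem_finiteRank]
  refine Submodule.finiteDimensional_of_le (S₂ := Submodule.span ℂ {y}) ?_
  rintro _ ⟨x, rfl⟩
  exact Submodule.smul_mem _ _ (Submodule.mem_span_singleton_self y)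

/-- The rank-one operator `y ⊗ φ : x ↦ φ x • y`, as an element of `F(X, Y)`. -/
def rankOneOp (φ : X →L[ℂ] ℂ) (y : Y) : finiteRank X Y :=
  ⟨φ.smulRight y, smulRight_mem_finiteRank φ y⟩

/-- Composition `S ↦ T S` with a fixed finite-rank operator `T`, as a linear map on all bounded
operators `S`. -/
def postcompFiniteRank (T : finiteRank Y Z) : (X →L[ℂ] Y) →ₗ[ℂ] finiteRank X Z where
  toFun S := ⟨(T : Y →L[ℂ] Z) ∘L S, comp_mem_finiteRank T.2 S⟩
  map_add' _ _ := by ext; simp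
  map_smul' _ _ := by ext; simp

theorem coe_postcompFiniteRank (T : finiteRank Y Z) (S : X →L[ℂ] Y) :
    (postcompFiniteRank T S : X →L[ℂ] Z) = (T : Y →L[ℂ] Z) ∘L S := rfl

theorem exists_eq_sum_rankOneOp (T : finiteRank X Y) :
    ∃ (n : ℕ) (φ : Fin n → X →L[ℂ] ℂ) (y : Fin n → Y), T = ∑ k, rankOneOp (φ k) (y k) := by
  obtain ⟨T, hT⟩ := T
  rw [mem_finiteRank] at hT
  let b := Module.finBasis ℂ (LinearMap.range T.toLinearMap)
  let coord k : X →L[ℂ] ℂ := LinearMap.toContinuousLinearMap (b.coord k) ∘L T.rangeRestrict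
  refine ⟨_, coord, fun k => b k, ?_⟩
  ext x
  have hx := congrArg Subtype.val (b.sum_repr (T.rangeRestrict x))
  rw [Submodule.coe_sum] at hx
  rw [Submodule.coe_sum, sum_apply]
  exact hx.symm

end FiniteRank

section Gamma

variable {U V W Y : Type*} [NormedAddCommGroup U] [NormedSpace ℂ U]
  [NormedAddCommGroup V] [NormedSpace ℂ V] [NormedAddCommGroup W] [NormedSpace ℂ W]
  [NormedAddCommGroup Y] [NormedSpace ℂ Y]

theorem gammaNorm_comp_le (R : finiteRank Y W) (S : finiteRank V Y) :
    gammaNorm Y (finiteRankComp V Y W R S) ≤ ‖R‖ * ‖S‖ := by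
  refine csInf_le ⟨0, ?_⟩ ⟨R, S, rfl, rfl⟩
  rintro _ ⟨R, S, -, rfl⟩
  positivity

theorem gammaNorm_rankOneOp_le {f : Y →L[ℂ] ℂ} {y : Y} (hy : f y = 1) (φ : V →L[ℂ] ℂ) (w : W) :
    gammaNorm Y (rankOneOp φ w) ≤ ‖f‖ * ‖y‖ * ‖w‖ * ‖φ‖ := by
  have hcomp : finiteRankComp V Y W (rankOneOp f w) (rankOneOp φ y) = rankOneOp φ w := by
    ext v
    simp [rankOneOp, hy]
  calc gammaNorm Y (rankOneOp φ w) ≤ ‖rankOneOp f w‖ * ‖rankOneOp φ y‖ :=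
        hcomp ▸ gammaNorm_comp_le _ _
    _ = ‖f‖ * ‖y‖ * ‖w‖ * ‖φ‖ := by
        simp only [rankOneOp, Submodule.coe_norm, ContinuousLinearMap.norm_smulRight_apply]
        ring

/-- A norm, in the sense of `IsNormOn`, as a bundled seminorm. -/
def IsNormOn.toSeminorm {E : Type*} [AddCommGroup E] [Module ℂ E] {N : E → ℝ} (hN : IsNormOn N) :
    Seminorm ℂ E :=
  Seminorm.of N hN.add_le hN.smul

theorem IsNormOn.exists_finiteRankComp_eq
    (hγ : IsNormOn (fun T : finiteRank V W => gammaNorm Y T)) (T : finiteRank V W) :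
    ∃ R S, finiteRankComp V Y W R S = T := by
  by_contra! hT
  have hempty : {r : ℝ | ∃ (R : finiteRank Y W) (S : finiteRank V Y),
      finiteRankComp V Y W R S = T ∧ r = ‖R‖ * ‖S‖} = ∅ :=
    Set.eq_empty_of_forall_notMem fun _ ⟨R, S, hRS, _⟩ => hT R S hRS
  have hzero : T = 0 := (hγ.eq_zero_iff T).1 (by rw [gammaNorm, hempty, Real.sInf_empty])
  exact hT 0 0 (by rw [hzero, map_zero])

theorem IsNormOn.nontrivial_of_ne_zero
    (hγ : IsNormOn (fun T : finiteRank V W => gammaNorm Y T)) {T : finiteRank V W} (hT : T ≠ 0) :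
    Nontrivial Y := by
  by_contra hY
  have := not_nontrivial_iff_subsingleton.1 hY
  obtain ⟨R, S, rfl⟩ := hγ.exists_finiteRankComp_eq T
  exact hT (by ext v; simp [Subsingleton.elim ((S : V →L[ℂ] Y) v) 0])

theorem isMOpen_of_gammaNorm_lt (hγ : IsNormOn (fun T : finiteRank V W => gammaNorm Y T)) {M : ℝ}
    (hM : ∀ T : finiteRank V W, T ≠ 0 → gammaNorm Y T < M * ‖T‖) :
    IsMOpen (E := finiteRank Y W) (F := finiteRank V Y) (G := finiteRank V W)
      (finiteRankComp V Y W) M := by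
  intro T
  by_cases hT : T = 0
  · exact ⟨0, 0, by simp [hT], by simp [hT]⟩
  · obtain ⟨R₀, S₀, h₀⟩ := hγ.exists_finiteRankComp_eq T
    obtain ⟨_, ⟨R, S, hRS, rfl⟩, hlt⟩ := exists_lt_of_csInf_lt
      (by exact ⟨_, R₀, S₀, h₀, rfl⟩) (hM T hT)
    exact ⟨R, S, hRS, hlt.le⟩

theorem tendsto_gammaNorm_postcompFiniteRank [Nontrivial Y]
    (hγ : IsNormOn (fun T : finiteRank V W => gammaNorm Y T)) (T : finiteRank U W)
    {ι : Type*} {l : Filter ι} {S : ι → V →L[ℂ] U}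
    (hS : ∀ φ : U →L[ℂ] ℂ, Tendsto (fun i => φ ∘L S i) l (𝓝 0)) :
    Tendsto (fun i => gammaNorm Y (postcompFiniteRank T (S i))) l (𝓝 0) := by
  obtain ⟨y, hy⟩ := exists_ne (0 : Y)
  obtain ⟨f, hf⟩ := SeparatingDual.exists_eq_one (R := ℂ) hy
  obtain ⟨n, φ, w, hT⟩ := exists_eq_sum_rankOneOp T
  have hsum i : postcompFiniteRank T (S i) = ∑ k, rankOneOp (φ k ∘L S i) (w k) := by
    ext v
    simp [hT, coe_postcompFiniteRank, rankOneOp]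
  have hle i : gammaNorm Y (postcompFiniteRank T (S i)) ≤
      ∑ k, ‖f‖ * ‖y‖ * ‖w k‖ * ‖φ k ∘L S i‖ := by
    rw [hsum]
    exact (Finset.le_sum_of_subadditive _ ((hγ.eq_zero_iff 0).2 rfl).le hγ.add_le _ _).trans
      (Finset.sum_le_sum fun k _ => gammaNorm_rankOneOp_le hf _ _)
  have hlim : Tendsto (fun i => ∑ k, ‖f‖ * ‖y‖ * ‖w k‖ * ‖φ k ∘L S i‖) l (𝓝 0) := by
    simpa using tendsto_finsetSum Finset.univ fun k _ =>
      (hS (φ k)).norm.const_mul (‖f‖ * ‖y‖ * ‖w k‖)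
  exact squeeze_zero (fun i => hγ.nonneg _) hle hlim

/-- The seminorm `S ↦ γ_Y(T S)` on bounded operators. Unlike `γ_Y` itself it is always
continuous for the operator norm, because all the operators `T S` have range in the
finite-dimensional range of `T`. -/
def IsNormOn.postcompSeminorm (hγ : IsNormOn (fun T : finiteRank V W => gammaNorm Y T))
    (T : finiteRank U W) : Seminorm ℂ (V →L[ℂ] U) :=
  hγ.toSeminorm.comp (postcompFiniteRank T)

theorem IsNormOn.continuous_postcompSeminorm [Nontrivial Y]
    (hγ : IsNormOn (fun T : finiteRank V W => gammaNorm Y T)) (T : finiteRank U W) :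
    Continuous (hγ.postcompSeminorm T) := by
  refine Seminorm.continuous_of_continuousAt_zero ?_
  rw [ContinuousAt, map_zero]
  refine tendsto_gammaNorm_postcompFiniteRank hγ T fun φ => ?_
  have hφ : Tendsto (fun S : V →L[ℂ] U => φ ∘L S) (𝓝 0) (𝓝 (φ ∘L 0)) :=
    (ContinuousLinearMap.compL ℂ V U ℂ φ).continuous.tendsto 0
  rwa [ContinuousLinearMap.comp_zero] at hφ

theorem gammaNorm_postcompFiniteRank_le_of_mem_closure [Nontrivial Y]
    (hγ : IsNormOn (fun T : finiteRank V W => gammaNorm Y T)) (R : finiteRank Y W)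
    {S : V →L[ℂ] Y} (hS : S ∈ closure (finiteRank V Y : Set (V →L[ℂ] Y))) :
    gammaNorm Y (postcompFiniteRank R S) ≤ ‖R‖ * ‖S‖ :=
  closure_minimal (t := {S | hγ.postcompSeminorm R S ≤ ‖R‖ * ‖S‖})
    (fun S hS => gammaNorm_comp_le R ⟨S, hS⟩)
    (isClosed_le (hγ.continuous_postcompSeminorm R) (continuous_const.mul continuous_norm)) hS

end Gamma

section Scalar

variable {X : Type*} [NormedAddCommGroup X] [NormedSpace ℂ X] {ι : Type*} {u : ι → X →L[ℂ] X}

theorem tendsto_functional_comp_of_commutator {l : Filter ι}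
    (hu : ∀ a ∈ finiteRank X X, Tendsto (fun i => a * u i - u i * a) l (𝓝 0))
    {φ₀ : X →L[ℂ] ℂ} {x₀ : X} (h₀ : φ₀ x₀ = 1) {μ : ℂ}
    (hμ : Tendsto (fun i => φ₀ (u i x₀)) l (𝓝 μ)) (φ : X →L[ℂ] ℂ) :
    Tendsto (fun i => φ ∘L u i) l (𝓝 (μ • φ)) := by
  let a : X →L[ℂ] X := φ.smulRight x₀
  have ha : Tendsto (fun i => φ₀ ∘L (a * u i - u i * a)) l (𝓝 (φ₀ ∘L 0)) :=
    ((ContinuousLinearMap.compL ℂ X X ℂ φ₀).continuous.tendsto 0).comp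
      (hu a (smulRight_mem_finiteRank φ x₀))
  rw [ContinuousLinearMap.comp_zero] at ha
  have hdecomp i : φ₀ ∘L (a * u i - u i * a) + φ₀ (u i x₀) • φ = φ ∘L u i := by
    ext x
    simp [a, h₀, mul_comm]
  simpa only [hdecomp, zero_add] using ha.add (hμ.smul_const φ)

theorem exists_tendsto_functional_comp [Nontrivial X] (U : Ultrafilter ι)
    (hu : ∀ a ∈ finiteRank X X, Tendsto (fun i => a * u i - u i * a) U (𝓝 0))
    {C : ℝ} (hC : ∀ i, ‖u i‖ ≤ C) :
    ∃ μ : ℂ, ∀ φ : X →L[ℂ] ℂ, Tendsto (fun i => φ ∘L u i) U (𝓝 (μ • φ)) := by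
  obtain ⟨x₀, hx₀⟩ := exists_ne (0 : X)
  obtain ⟨φ₀, h₀⟩ := SeparatingDual.exists_eq_one (R := ℂ) hx₀
  have hbound i : φ₀ (u i x₀) ∈ Metric.closedBall 0 (‖φ₀‖ * (C * ‖x₀‖)) :=
    mem_closedBall_zero_iff.2 <| φ₀.le_opNorm_of_le <| (u i).le_of_opNorm_le (hC i) x₀
  obtain ⟨μ, -, hμ⟩ := (isCompact_closedBall (0 : ℂ) _).ultrafilter_le_nhds
    (U.map fun i => φ₀ (u i x₀)) (tendsto_principal.2 (Eventually.of_forall hbound))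
  exact ⟨μ, tendsto_functional_comp_of_commutator hu h₀ hμ⟩

theorem eq_one_of_tendsto_functional_comp [Nontrivial X] {l : Filter ι} [l.NeBot]
    (hu : ∀ a ∈ finiteRank X X, Tendsto (fun i => u i * a) l (𝓝 a)) {μ : ℂ}
    (hμ : ∀ φ : X →L[ℂ] ℂ, Tendsto (fun i => φ ∘L u i) l (𝓝 (μ • φ))) : μ = 1 := by
  obtain ⟨x₀, hx₀⟩ := exists_ne (0 : X)
  obtain ⟨φ₀, h₀⟩ := SeparatingDual.exists_eq_one (R := ℂ) hx₀
  let a : X →L[ℂ] X := φ₀.smulRight x₀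
  have hone : Tendsto (fun i => φ₀ ((u i * a) x₀)) l (𝓝 (φ₀ (a x₀))) :=
    ((φ₀ ∘L ContinuousLinearMap.apply ℂ X x₀).continuous.tendsto a).comp
      (hu a (smulRight_mem_finiteRank φ₀ x₀))
  have hmu : Tendsto (fun i => φ₀ (u i x₀)) l (𝓝 (μ * φ₀ x₀)) :=
    ((ContinuousLinearMap.apply ℂ ℂ x₀).continuous.tendsto (μ • φ₀)).comp (hμ φ₀)
  exact tendsto_nhds_unique (by simpa [h₀] using hmu) (by simpa [a, h₀] using hone)

end Scalar

section Sandwich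

variable {X : Type*} [NormedAddCommGroup X] [NormedSpace ℂ X]

theorem finiteRank_subset_approximableAlgebra :
    (finiteRank X X : Set (X →L[ℂ] X)) ⊆ approximableAlgebra X :=
  subset_closure

instance [Nontrivial X] : Nontrivial (approximableAlgebra X) := by
  obtain ⟨x₀, hx₀⟩ := exists_ne (0 : X)
  obtain ⟨φ₀, h₀⟩ := SeparatingDual.exists_eq_one (R := ℂ) hx₀
  refine ⟨⟨φ₀.smulRight x₀,
    finiteRank_subset_approximableAlgebra (smulRight_mem_finiteRank φ₀ x₀)⟩, 0, fun h => hx₀ ?_⟩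
  simpa [h₀] using DFunLike.congr_fun (congrArg Subtype.val h) x₀

theorem mul_mem_approximableAlgebra {a : X →L[ℂ] X} (ha : a ∈ approximableAlgebra X)
    (B : X →L[ℂ] X) : a * B ∈ approximableAlgebra X :=
  map_mem_closure (f := (· * B)) (continuous_mul_const B) ha fun _ hT => comp_mem_finiteRank hT B

/-- Right multiplication `a ↦ a B` by a bounded operator `B`, as a map of `A(X)` into itself. -/
def approximableMulRight (B : X →L[ℂ] X) : approximableAlgebra X →L[ℂ] approximableAlgebra X :=
  LinearMap.mkContinuous
    { toFun := fun a => ⟨a * B, mul_mem_approximableAlgebra a.2 B⟩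
      map_add' := fun _ _ => Subtype.ext (add_mul _ _ _)
      map_smul' := fun _ _ => Subtype.ext (smul_mul_assoc _ _ _) }
    ‖B‖ fun a => (norm_mul_le (a : X →L[ℂ] X) B).trans_eq (mul_comm _ _)

variable [CompleteSpace X]

/-- The continuous linear map `a ⊗ b ↦ a B b` from the projective tensor square of `A(X)` to
`B(X)`. -/
def sandwich (B : X →L[ℂ] X) : ProjTensorSq (approximableAlgebra X) →L[ℂ] (X →L[ℂ] X) :=
  (approximableAlgebra X).toSubmodule.subtypeL ∘L twistedMul (approximableMulRight B)

theorem coe_twistedMul_approximableMulRight (B : X →L[ℂ] X)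
    (d : ProjTensorSq (approximableAlgebra X)) :
    ((twistedMul (approximableMulRight B) d : approximableAlgebra X) : X →L[ℂ] X) =
      sandwich B d := rfl

theorem sandwich_tprod (B : X →L[ℂ] X) (m : Fin 2 → approximableAlgebra X) :
    sandwich B (ProjTensorSq.tprod m) = m 0 * B * m 1 := by
  rw [← coe_twistedMul_approximableMulRight, twistedMul_tprod]
  rfl

theorem norm_sandwich_le (B : X →L[ℂ] X) (d : ProjTensorSq (approximableAlgebra X)) :
    ‖sandwich B d‖ ≤ ‖B‖ * ‖d‖ := by
  have hN : Continuous ((normSeminorm ℂ (X →L[ℂ] X)).comp (sandwich B).toLinearMap) :=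
    (sandwich B).continuous.norm
  refine ProjTensorSq.seminorm_le hN (norm_nonneg B) (fun m => ?_) d
  calc ‖sandwich B (ProjTensorSq.tprod m)‖
      = ‖(m 0 : X →L[ℂ] X) * B * m 1‖ := by rw [sandwich_tprod]
    _ ≤ ‖m 0‖ * ‖B‖ * ‖m 1‖ := norm_mul₃_le
    _ = ‖B‖ * (‖m 0‖ * ‖m 1‖) := by ring

theorem sandwich_add_sandwich {P Q : X →L[ℂ] X} (hPQ : P + Q = 1)
    (d : ProjTensorSq (approximableAlgebra X)) :
    sandwich P d + sandwich Q d =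
      (projMul (approximableAlgebra X) d : approximableAlgebra X) := by
  have hadd : sandwich P + sandwich Q =
      (approximableAlgebra X).toSubmodule.subtypeL ∘L projMul (approximableAlgebra X) :=
    ProjTensorSq.clm_ext fun m => by
      rw [add_apply, sandwich_tprod, sandwich_tprod, ← add_mul, ← mul_add, hPQ, mul_one]
      simp [projMul_tprod]
  exact DFunLike.congr_fun hadd d

theorem tendsto_commutator_sandwich {ι : Type*} {l : Filter ι}
    {d : ι → ProjTensorSq (approximableAlgebra X)}
    (hd : ∀ a, Tendsto (fun i => projLeft a (d i) - projRight a (d i)) l (𝓝 0))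
    (B : X →L[ℂ] X) {a : X →L[ℂ] X} (ha : a ∈ finiteRank X X) :
    Tendsto (fun i => a * sandwich B (d i) - sandwich B (d i) * a) l (𝓝 0) :=
  (continuous_subtype_val.tendsto 0).comp <|
    tendsto_commutator_twistedMul (hd ⟨a, finiteRank_subset_approximableAlgebra ha⟩)
      (f := approximableMulRight B) fun _ _ => Subtype.ext (mul_assoc _ _ _)

theorem exists_tendsto_functional_comp_sandwich [Nontrivial X] {ι : Type*} (U : Ultrafilter ι)
    {d : ι → ProjTensorSq (approximableAlgebra X)} {K : ℝ} (hK : ∀ i, ‖d i‖ ≤ K)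
    (hd : ∀ a, Tendsto (fun i => projLeft a (d i) - projRight a (d i)) U (𝓝 0))
    (B : X →L[ℂ] X) :
    ∃ μ : ℂ, ∀ φ : X →L[ℂ] ℂ, Tendsto (fun i => φ ∘L sandwich B (d i)) U (𝓝 (μ • φ)) :=
  exists_tendsto_functional_comp U (fun _ => tendsto_commutator_sandwich hd B)
    fun i => (norm_sandwich_le B (d i)).trans <|
      mul_le_mul_of_nonneg_left (hK i) (norm_nonneg _)

theorem add_eq_one_of_tendsto_sandwich [Nontrivial X] {ι : Type*} {l : Filter ι} [l.NeBot]
    {d : ι → ProjTensorSq (approximableAlgebra X)}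
    (hd : ∀ a, Tendsto (fun i => projMul (approximableAlgebra X) (d i) * a) l (𝓝 a))
    {P Q : X →L[ℂ] X} (hPQ : P + Q = 1) {μ ν : ℂ}
    (hμ : ∀ φ : X →L[ℂ] ℂ, Tendsto (fun i => φ ∘L sandwich P (d i)) l (𝓝 (μ • φ)))
    (hν : ∀ φ : X →L[ℂ] ℂ, Tendsto (fun i => φ ∘L sandwich Q (d i)) l (𝓝 (ν • φ))) :
    μ + ν = 1 := by
  refine eq_one_of_tendsto_functional_comp
    (u := fun i => (projMul (approximableAlgebra X) (d i) : X →L[ℂ] X)) (l := l)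
    (fun a ha => ?_) fun φ => ?_
  · exact (continuous_subtype_val.tendsto _).comp
      (hd ⟨a, finiteRank_subset_approximableAlgebra ha⟩)
  · rw [show (μ + ν) • φ = μ • φ + ν • φ from add_smul μ ν φ]
    simpa only [← sandwich_add_sandwich hPQ, ContinuousLinearMap.comp_add]
      using (hμ φ).add (hν φ)

end Sandwich

section Factorization

variable {X V W Y : Type*} [NormedAddCommGroup X] [NormedSpace ℂ X] [CompleteSpace X]
  [NormedAddCommGroup V] [NormedSpace ℂ V] [NormedAddCommGroup W] [NormedSpace ℂ W]
  [NormedAddCommGroup Y] [NormedSpace ℂ Y] [Nontrivial Y]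

theorem gammaNorm_sandwich_le (hγ : IsNormOn (fun T : finiteRank V W => gammaNorm Y T))
    (T : finiteRank X W) (i : Y →L[ℂ] X) (p : X →L[ℂ] Y) (j : V →L[ℂ] X)
    (d : ProjTensorSq (approximableAlgebra X)) :
    gammaNorm Y (postcompFiniteRank T (sandwich (i ∘L p) d ∘L j)) ≤
      ‖T‖ * ‖i‖ * ‖p‖ * ‖j‖ * ‖d‖ := by
  let L : ProjTensorSq (approximableAlgebra X) →L[ℂ] (V →L[ℂ] X) :=
    (ContinuousLinearMap.compL ℂ V X X).flip j ∘L sandwich (i ∘L p)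
  have hN : Continuous ((hγ.postcompSeminorm T).comp L.toLinearMap) :=
    (hγ.continuous_postcompSeminorm T).comp L.continuous
  refine ProjTensorSq.seminorm_le hN (by positivity) (fun m => ?_) d
  let R : finiteRank Y W := postcompFiniteRank T ((m 0 : X →L[ℂ] X) ∘L i)
  let S : V →L[ℂ] Y := p ∘L (m 1 : X →L[ℂ] X) ∘L j
  have hfactor : postcompFiniteRank T (L (ProjTensorSq.tprod m)) = postcompFiniteRank R S := by
    ext v
    simp [L, R, S, sandwich_tprod, coe_postcompFiniteRank]
  have hS : S ∈ closure (finiteRank V Y : Set (V →L[ℂ] Y)) :=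
    map_mem_closure (f := fun b : X →L[ℂ] X => p ∘L b ∘L j) (by fun_prop) (m 1).2
      fun _ hb => comp_mem_finiteRank_right p (comp_mem_finiteRank hb j)
  have hR_norm : ‖R‖ ≤ ‖T‖ * (‖m 0‖ * ‖i‖) :=
    (ContinuousLinearMap.opNorm_comp_le _ _).trans <| mul_le_mul_of_nonneg_left
      (ContinuousLinearMap.opNorm_comp_le _ _) (norm_nonneg _)
  have hS_norm : ‖S‖ ≤ ‖p‖ * (‖m 1‖ * ‖j‖) :=
    (ContinuousLinearMap.opNorm_comp_le _ _).trans <| mul_le_mul_of_nonneg_left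
      (ContinuousLinearMap.opNorm_comp_le _ _) (norm_nonneg _)
  calc gammaNorm Y (postcompFiniteRank T (L (ProjTensorSq.tprod m)))
      = gammaNorm Y (postcompFiniteRank R S) := by rw [hfactor]
    _ ≤ ‖R‖ * ‖S‖ := gammaNorm_postcompFiniteRank_le_of_mem_closure hγ R hS
    _ ≤ (‖T‖ * (‖m 0‖ * ‖i‖)) * (‖p‖ * (‖m 1‖ * ‖j‖)) := by gcongr
    _ = ‖T‖ * ‖i‖ * ‖p‖ * ‖j‖ * (‖m 0‖ * ‖m 1‖) := by ring

theorem norm_mul_gammaNorm_le_of_tendsto_sandwich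
    (hγ : IsNormOn (fun T : finiteRank V W => gammaNorm Y T)) (T : finiteRank X W)
    {i : Y →L[ℂ] X} {p : X →L[ℂ] Y} (j : V →L[ℂ] X) {ι : Type*} {l : Filter ι} [l.NeBot]
    {d : ι → ProjTensorSq (approximableAlgebra X)} {K : ℝ} (hd : ∀ n, ‖d n‖ ≤ K) {μ : ℂ}
    (hμ : ∀ φ : X →L[ℂ] ℂ, Tendsto (fun n => φ ∘L sandwich (i ∘L p) (d n)) l (𝓝 (μ • φ))) :
    ‖μ‖ * gammaNorm Y (postcompFiniteRank T j) ≤ ‖T‖ * ‖i‖ * ‖p‖ * ‖j‖ * K := by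
  let u n : V →L[ℂ] X := sandwich (i ∘L p) (d n) ∘L j
  let N := hγ.postcompSeminorm T
  have herror : Tendsto (fun n => N (μ • j - u n)) l (𝓝 0) := by
    refine tendsto_gammaNorm_postcompFiniteRank hγ T fun φ => ?_
    have hφ : Tendsto (fun n => (μ • φ - φ ∘L sandwich (i ∘L p) (d n)) ∘L j) l
        (𝓝 ((μ • φ - μ • φ) ∘L j)) :=
      (((ContinuousLinearMap.compL ℂ V X ℂ).flip j).continuous.tendsto _).comp
        ((hμ φ).const_sub _)
    rw [sub_self, ContinuousLinearMap.zero_comp] at hφ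
    refine hφ.congr fun n => ?_
    ext v
    simp [u]
  have hle n : ‖μ‖ * N j ≤ ‖T‖ * ‖i‖ * ‖p‖ * ‖j‖ * K + N (μ • j - u n) :=
    calc ‖μ‖ * N j = N (u n + (μ • j - u n)) := by rw [add_sub_cancel, map_smul_eq_mul]
      _ ≤ N (u n) + N (μ • j - u n) := map_add_le_add N _ _
      _ ≤ ‖T‖ * ‖i‖ * ‖p‖ * ‖j‖ * ‖d n‖ + N (μ • j - u n) := by
        gcongr
        exact gammaNorm_sandwich_le hγ T i p j (d n)
      _ ≤ ‖T‖ * ‖i‖ * ‖p‖ * ‖j‖ * K + N (μ • j - u n) := by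
        gcongr
        exact hd n
  exact ge_of_tendsto' (by simpa using herror.const_add (‖T‖ * ‖i‖ * ‖p‖ * ‖j‖ * K)) hle

end Factorization

section Main

variable {X : Type*} [NormedAddCommGroup X] [NormedSpace ℂ X]

theorem one_le_norm_of_isIdempotentElem {P : X →L[ℂ] X} (hP : IsIdempotentElem P) (h0 : P ≠ 0) :
    1 ≤ ‖P‖ := by
  have hle : ‖P‖ ≤ ‖P‖ * ‖P‖ := by simpa only [hP.eq] using norm_mul_le P P
  exact (le_mul_iff_one_le_right (norm_pos_iff.2 h0)).1 hle

theorem nontrivial_of_not_finiteDimensional {Y : Type*} [AddCommGroup Y] [Module ℂ Y]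
    (hY : ¬ FiniteDimensional ℂ Y) : Nontrivial Y :=
  not_subsingleton_iff_nontrivial.1 fun _ => hY inferInstance

theorem norm_rangeRestrict_le (P : X →L[ℂ] X) : ‖P.rangeRestrict‖ ≤ ‖P‖ :=
  ContinuousLinearMap.opNorm_le_bound _ (norm_nonneg _) P.le_opNorm

variable [CompleteSpace X]

theorem gammaNorm_rg_le {P Q : X →L[ℂ] X} (hQ : IsIdempotentElem Q) [Nontrivial (rg P)]
    (hγ : IsNormOn (fun T : finiteRank (rg Q) (rg Q) => gammaNorm (rg P) T))
    {ι : Type*} {l : Filter ι} [l.NeBot] {d : ι → ProjTensorSq (approximableAlgebra X)} {K : ℝ}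
    (hd : ∀ n, ‖d n‖ ≤ K) {μ : ℂ}
    (hμ : ∀ φ : X →L[ℂ] ℂ, Tendsto (fun n => φ ∘L sandwich P (d n)) l (𝓝 (μ • φ)))
    (T : finiteRank (rg Q) (rg Q)) :
    ‖μ‖ * gammaNorm (rg P) T ≤ K * ‖P‖ * ‖Q‖ * ‖T‖ := by
  let TQ : finiteRank X (rg Q) := postcompFiniteRank T Q.rangeRestrict
  have hTQ : postcompFiniteRank TQ (rg Q).subtypeL = T := by
    ext ⟨_, x, rfl⟩
    have hx : Q.rangeRestrict (Q x) = ⟨Q x, x, rfl⟩ := Subtype.ext (DFunLike.congr_fun hQ x)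
    simp [TQ, coe_postcompFiniteRank, hx]
  have hTQ_norm : ‖TQ‖ ≤ ‖T‖ * ‖Q‖ :=
    (ContinuousLinearMap.opNorm_comp_le _ _).trans <|
      mul_le_mul_of_nonneg_left (norm_rangeRestrict_le Q) (norm_nonneg _)
  have hK : 0 ≤ K := let ⟨n⟩ := l.nonempty_of_neBot; (norm_nonneg _).trans (hd n)
  calc ‖μ‖ * gammaNorm (rg P) T
      ≤ ‖TQ‖ * ‖(rg P).subtypeL‖ * ‖P.rangeRestrict‖ * ‖(rg Q).subtypeL‖ * K := by
        rw [← hTQ]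
        exact norm_mul_gammaNorm_le_of_tendsto_sandwich hγ TQ (rg Q).subtypeL hd hμ
    _ ≤ ‖T‖ * ‖Q‖ * 1 * ‖P‖ * 1 * K := by
        gcongr
        exacts [(rg P).norm_subtypeL_le, norm_rangeRestrict_le P, (rg Q).norm_subtypeL_le]
    _ = K * ‖P‖ * ‖Q‖ * ‖T‖ := by ring

theorem isMOpen_finiteRankComp_rg {P Q : X →L[ℂ] X} (hQ : IsIdempotentElem Q)
    (hγ : IsNormOn (fun T : finiteRank (rg Q) (rg Q) => gammaNorm (rg P) T))
    {ι : Type*} {l : Filter ι} [l.NeBot] {d : ι → ProjTensorSq (approximableAlgebra X)} {K : ℝ}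
    (hd : ∀ n, ‖d n‖ ≤ K) {μ : ℂ} (hμ_norm : 1 / 2 ≤ ‖μ‖)
    (hμ : ∀ φ : X →L[ℂ] ℂ, Tendsto (fun n => φ ∘L sandwich P (d n)) l (𝓝 (μ • φ)))
    {M : ℝ} (hM : 2 * K * ‖P‖ * ‖Q‖ < M) :
    IsMOpen (E := finiteRank (rg P) (rg Q)) (F := finiteRank (rg Q) (rg P))
      (G := finiteRank (rg Q) (rg Q)) (finiteRankComp (rg Q) (rg P) (rg Q)) M := by
  refine isMOpen_of_gammaNorm_lt hγ fun T hT => ?_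
  have := hγ.nontrivial_of_ne_zero hT
  have hhalf : 1 / 2 * gammaNorm (rg P) T ≤ ‖μ‖ * gammaNorm (rg P) T :=
    mul_le_mul_of_nonneg_right hμ_norm (hγ.nonneg T)
  calc gammaNorm (rg P) T ≤ 2 * K * ‖P‖ * ‖Q‖ * ‖T‖ := by
        linarith [gammaNorm_rg_le hQ hγ hd hμ T]
    _ < M * ‖T‖ := mul_lt_mul_of_pos_right hM (norm_pos_iff.2 hT)

end Main

theorem half_le_norm_or_half_le_norm {μ ν : ℂ} (h : μ + ν = 1) : 1 / 2 ≤ ‖μ‖ ∨ 1 / 2 ≤ ‖ν‖ := by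
  have hsum : 1 ≤ ‖μ‖ + ‖ν‖ := by simpa [h] using norm_add_le μ ν
  by_contra! hlt
  linarith [hlt.1, hlt.2]

theorem two_mul_lt_factorizationConstant {K p q : ℝ} (hK : 1 ≤ K) (hp : 1 ≤ p) (hq : 1 ≤ q) :
    2 * K * p * q < (4 * K ^ 2 * p * q * max (p ^ 4) (q ^ 4)) ^ 2 * K ^ 2 * p * q := by
  set κ := 4 * K ^ 2 * p * q * max (p ^ 4) (q ^ 4) with hκ
  have hmax : 1 ≤ max (p ^ 4) (q ^ 4) := le_max_of_le_left (one_le_pow₀ hp)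
  have hκ_four : 4 ≤ κ := by
    rw [hκ, mul_assoc, mul_assoc, mul_assoc]
    exact le_mul_of_one_le_right zero_le_four <| one_le_mul_of_one_le_of_one_le (one_le_pow₀ hK) <|
      one_le_mul_of_one_le_of_one_le hp <| one_le_mul_of_one_le_of_one_le hq hmax
  have hK_sq : K ≤ K ^ 2 := le_self_pow₀ hK two_ne_zero
  have hlt : 2 * K < κ ^ 2 * K ^ 2 := by
    calc 2 * K < 4 ^ 2 * K ^ 2 := by linarith
      _ ≤ κ ^ 2 * K ^ 2 := by gcongr
  gcongr

theorem mainTheorem11_general {X : Type*} [NormedAddCommGroup X] [NormedSpace ℂ X]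
    [CompleteSpace X] [Nontrivial X] {K : ℝ} (hK : IsKAmenable (approximableAlgebra X) K)
    {P Q : X →L[ℂ] X} (hP : IsIdempotentElem P) (hPQ : P + Q = 1)
    (hY : IsNormOn fun T : finiteRank (rg Q) (rg Q) => gammaNorm (rg P) T)
    (hZ : IsNormOn fun T : finiteRank (rg P) (rg P) => gammaNorm (rg Q) T)
    {M : ℝ} (hM : 2 * K * ‖P‖ * ‖Q‖ < M) :
    IsMOpen (E := finiteRank (rg Q) (rg P)) (F := finiteRank (rg P) (rg Q))
        (G := finiteRank (rg P) (rg P)) (finiteRankComp (rg P) (rg Q) (rg P)) M ∨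
      IsMOpen (E := finiteRank (rg P) (rg Q)) (F := finiteRank (rg Q) (rg P))
        (G := finiteRank (rg Q) (rg Q)) (finiteRankComp (rg Q) (rg P) (rg Q)) M := by
  have hQ : IsIdempotentElem Q := eq_sub_of_add_eq' hPQ ▸ hP.one_sub
  obtain ⟨ι, _, _, _, d, hd, happrox, hcomm⟩ := hK
  let U : Ultrafilter ι := .of atTop
  have hU : (U : Filter ι) ≤ atTop := Ultrafilter.of_le atTop
  have hcommU a := (hcomm a).mono_left hU
  obtain ⟨μ, hμ⟩ := exists_tendsto_functional_comp_sandwich U hd hcommU P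
  obtain ⟨ν, hν⟩ := exists_tendsto_functional_comp_sandwich U hd hcommU Q
  have hsum : μ + ν = 1 :=
    add_eq_one_of_tendsto_sandwich (fun a => (happrox a).mono_left hU) hPQ hμ hν
  rcases half_le_norm_or_half_le_norm hsum with hμ_norm | hν_norm
  · exact .inr (isMOpen_finiteRankComp_rg hQ hY hd hμ_norm hμ hM)
  · exact .inl (isMOpen_finiteRankComp_rg hP hZ hd hν_norm hν (by rwa [mul_right_comm]))

end

theorem mainTheorem11 {X : Type*} [NormedAddCommGroup X] [NormedSpace ℂ X] [CompleteSpace X]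
    (hX : ¬ FiniteDimensional ℂ X) (K : ℝ) (hK : IsKAmenable (approximableAlgebra X) K)
    (P : X →L[ℂ] X) (hP : P ∘L P = P)
    (hY : HasFactorizationNormProperty (rg P))
    (hZ : HasFactorizationNormProperty (rg (ContinuousLinearMap.id ℂ X - P))) :
    ∃ κ M : ℝ, 0 ≤ κ ∧
      κ ≤ 4 * K ^ 2 * ‖P‖ * ‖ContinuousLinearMap.id ℂ X - P‖ *
        max (‖P‖ ^ 4) (‖ContinuousLinearMap.id ℂ X - P‖ ^ 4) ∧
      M ≤ κ ^ 2 * K ^ 2 * ‖P‖ * ‖ContinuousLinearMap.id ℂ X - P‖ ∧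
      (IsMOpen (finiteRankComp (rg P) (rg (ContinuousLinearMap.id ℂ X - P)) (rg P)) M ∨
        IsMOpen (finiteRankComp (rg (ContinuousLinearMap.id ℂ X - P)) (rg P)
          (rg (ContinuousLinearMap.id ℂ X - P))) M) := by
  have hQ : IsIdempotentElem (ContinuousLinearMap.id ℂ X - P) := IsIdempotentElem.one_sub hP
  have : CompleteSpace (rg P) :=
    (ContinuousLinearMap.IsIdempotentElem.isClosed_range hP).completeSpace_coe
  have : CompleteSpace (rg (ContinuousLinearMap.id ℂ X - P)) :=
    (ContinuousLinearMap.IsIdempotentElem.isClosed_range hQ).completeSpace_coe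
  have : Nontrivial X := nontrivial_of_not_finiteDimensional hX
  have hP_norm : 1 ≤ ‖P‖ :=
    one_le_norm_of_isIdempotentElem hP (ne_of_mem_of_not_mem (finiteRank X X).zero_mem hY.1).symm
  have hQ_norm : 1 ≤ ‖ContinuousLinearMap.id ℂ X - P‖ :=
    one_le_norm_of_isIdempotentElem hQ (ne_of_mem_of_not_mem (finiteRank X X).zero_mem hZ.1).symm
  exact ⟨_, _, by positivity, le_rfl, le_rfl,
    mainTheorem11_general hK hP (add_sub_cancel P 1) (hY.isNormOn _ _) (hZ.isNormOn _ _)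
      (two_mul_lt_factorizationConstant hK.one_le hP_norm hQ_norm)⟩
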